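/- Let $\mathbb D=\{w\in\mathbb C:|w|<1\}$ and, for $\lambda,\mu\in\mathbb D$, let $$k_\lambda(\mu)=\frac{1}{\overline\lambda\mu}\log\frac{1}{1-\overline\lambda\mu}$$ (interpreted as $1$ when $\overline\lambda\mu=0$). Then $k$ is the reproducing kernel of a Hilbert space of functions on $\mathbb D$. Moreover, let $\mathcal H$ be any Hilbert space of functions on $\mathbb D$ with reproducing kernel $k$ (the Dirichlet space). Then all elements of $\mathcal H$ are analytic on $\mathbb D$, and $\mathcal H$ is a complete interpolation space, that is: for all positive integers $m$ and $n$, all distinct points $\lambda_1,\dots,\lambda_n\in\mathbb D$ and all complex $m\times m$ matrices $z_1,\dots,z_n$, the following two conditions are equivalent. (i) There is a holomorphic $m\times m$-matrix-valued function $\varphi$ on $\mathbb D$ with $\varphi(\lambda_i)=z_i$ for each $i$ such that $f\mapsto\varphi f$ (pointwise product of a matrix and a column vector) maps $\mathbb C^m\otimes\mathcal H$ into itself with operator norm at most $1$. (ii) The $mn\times mn$ matrix whose $m\times m$ block in row $i$ and column $j$ is $(1-z_iz_j^*)\,k_{\lambda_j}(\lambda_i)$ is positive semidefinite. -/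

import Mathlib

/-- The open unit disc in the complex plane, centred at the origin. -/
abbrev unitDisc : Set ℂ := Metric.ball (0 : ℂ) 1

/-- The scalar reproducing kernel of a Hilbert space `H` of complex functions on `U`:
`reproducingKernel H lam mu = k_lam(mu)`, where `k_lam ∈ H` is the vector representing evaluation
at `lam`. It is linear/holomorphic in `mu` and conjugate-symmetric. -/
noncomputable def reproducingKernel {U : Set ℂ} (H : Type*) [NormedAddCommGroup H]
    [InnerProductSpace ℂ H] [CompleteSpace H] [RKHS ℂ H U ℂ] (lam mu : U) : ℂ :=
  (RKHS.kerFun H lam (1 : ℂ)) mu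

/-- Every element of `H`, a space of functions on `U`, is the restriction to `U` of a function
that is complex differentiable on `U`. -/
def IsSpaceOfAnalyticFunctions {U : Set ℂ} (H : Type*) [NormedAddCommGroup H]
    [InnerProductSpace ℂ H] [RKHS ℂ H U ℂ] : Prop :=
  ∀ f : H, ∃ F : ℂ → ℂ, DifferentiableOn ℂ F U ∧ ∀ w : U, F w = f w

/-- `φ` is a multiplier of `ℂᵐ ⊗ H`, of multiplier norm at most `1`. Here `ℂᵐ ⊗ H` is realized as
the Hilbert direct sum of `m` copies of `H` (column vectors of functions in `H`), and `φ` acts by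
the pointwise product `(φ f)(w) = φ(w) f(w)`; the norm is the operator norm of `f ↦ φ f`. -/
def IsContractiveMultiplier {U : Set ℂ} (H : Type*) [NormedAddCommGroup H]
    [InnerProductSpace ℂ H] [RKHS ℂ H U ℂ] {m : ℕ}
    (φ : ℂ → Matrix (Fin m) (Fin m) ℂ) : Prop :=
  ∃ T : PiLp 2 (fun _ : Fin m => H) →L[ℂ] PiLp 2 (fun _ : Fin m => H),
    (∀ (f : PiLp 2 (fun _ : Fin m => H)) (w : U) (a : Fin m),
      (T f a) w = ∑ b, φ w a b * (f b) w) ∧ ‖T‖ ≤ 1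

/-- The `mn × mn` Pick matrix: its `n × n` block in position `(i, j)` is
`(1 - z_i z_j^*) k_{lam_j}(lam_i)`. -/
noncomputable def pickMatrix {U : Set ℂ} (H : Type*) [NormedAddCommGroup H]
    [InnerProductSpace ℂ H] [CompleteSpace H] [RKHS ℂ H U ℂ] {m n : ℕ}
    (lam : Fin n → U) (z : Fin n → Matrix (Fin m) (Fin m) ℂ) :
    Matrix (Fin n × Fin m) (Fin n × Fin m) ℂ :=
  Matrix.of fun p q =>
    ((1 : Matrix (Fin m) (Fin m) ℂ) - z p.1 * (z q.1).conjTranspose) p.2 q.2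
      * reproducingKernel H (lam q.1) (lam p.1)

open scoped ComplexOrder in
/-- `m`-interpolation space: for all finite sets of distinct nodes and all `m × m` matrix targets,
the interpolation problem is solved by a holomorphic contractive multiplier if and only if the
Pick matrix is positive semidefinite. -/
def IsInterpolationSpace {U : Set ℂ} (H : Type*) [NormedAddCommGroup H]
    [InnerProductSpace ℂ H] [CompleteSpace H] [RKHS ℂ H U ℂ] (m : ℕ) : Prop :=
  ∀ n : ℕ, 0 < n → ∀ lam : Fin n → U, Function.Injective lam →
    ∀ z : Fin n → Matrix (Fin m) (Fin m) ℂ,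
      (∃ φ : ℂ → Matrix (Fin m) (Fin m) ℂ,
          (∀ a b, DifferentiableOn ℂ (fun w => φ w a b) U) ∧
          (∀ i, φ (lam i) = z i) ∧
          IsContractiveMultiplier H φ) ↔
        (pickMatrix H lam z).PosSemidef

/-- Complete interpolation space: an `m`-interpolation space for every positive integer `m`. -/
def IsCompleteInterpolationSpace {U : Set ℂ} (H : Type*) [NormedAddCommGroup H]
    [InnerProductSpace ℂ H] [CompleteSpace H] [RKHS ℂ H U ℂ] : Prop :=
  ∀ m : ℕ, 0 < m → IsInterpolationSpace H m

/-- The Dirichlet kernel `k_lam(mu) = (1 / (conj lam * mu)) log (1 / (1 - conj lam * mu))`, with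
the removable singularity at `conj lam * mu = 0` filled in by its limit `1`. On the disc
`1 / (1 - conj lam * mu)` has positive real part, so the principal branch is the right one. -/
noncomputable def dirichletKernel (lam mu : ℂ) : ℂ :=
  if starRingEnd ℂ lam * mu = 0 then 1
  else 1 / (starRingEnd ℂ lam * mu) * Complex.log (1 / (1 - starRingEnd ℂ lam * mu))

/-- `H` is a Hilbert space of functions on the unit disc whose reproducing kernel is the
Dirichlet kernel. -/
def HasDirichletKernel (H : Type*) [NormedAddCommGroup H]
    [InnerProductSpace ℂ H] [CompleteSpace H] [RKHS ℂ H unitDisc ℂ] : Prop :=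
  ∀ lam mu : unitDisc, reproducingKernel H lam mu = dirichletKernel lam mu

/-- The Dirichlet kernel as an operator-valued kernel on the disc. -/
noncomputable def dirichletKernelMatrix : Matrix unitDisc unitDisc (ℂ →L[ℂ] ℂ) :=
  Matrix.of fun mu lam => dirichletKernel lam mu • ContinuousLinearMap.id ℂ ℂ

lemma norm_conj_mul_lt_one (lam mu : unitDisc) :
    ‖starRingEnd ℂ (lam : ℂ) * (mu : ℂ)‖ < 1 := by
  have h1 : ‖(lam : ℂ)‖ < 1 := mem_ball_zero_iff.1 lam.2
  have h2 : ‖(mu : ℂ)‖ < 1 := mem_ball_zero_iff.1 mu.2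
  rw [norm_mul, RCLike.norm_conj]
  nlinarith [norm_nonneg (lam : ℂ), norm_nonneg (mu : ℂ)]

lemma hasSum_dirichletKernel (lam mu : unitDisc) :
    HasSum (fun n : ℕ => (starRingEnd ℂ (lam : ℂ) * (mu : ℂ)) ^ n / ((n : ℂ) + 1))
      (dirichletKernel lam mu) := by
  have hz := norm_conj_mul_lt_one lam mu
  unfold dirichletKernel
  generalize starRingEnd ℂ (lam : ℂ) * (mu : ℂ) = z at hz ⊢
  split_ifs with h
  · subst h
    convert hasSum_ite_eq (0 : ℕ) (1 : ℂ) using 2 with n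
    by_cases hn : n = 0 <;> simp [hn]
  · have hs := (hasSum_nat_add_iff' 1).2 (Complex.hasSum_taylorSeries_neg_log hz)
    have hre : 0 < (1 - z).re := by
      have := Complex.re_le_norm z
      simp
      linarith
    have harg : (1 - z).arg ≠ Real.pi := by
      intro hc
      rw [Complex.arg_eq_pi_iff] at hc
      linarith [hc.1]
    rw [one_div (1 - z), Complex.log_inv _ harg]
    have := hs.mul_left (1 / z)
    simp only [Finset.range_one, Finset.sum_singleton, pow_zero, Nat.cast_zero, div_zero,
      sub_zero] at this
    refine (congrArg (fun f : ℕ → ℂ => HasSum f _) (funext fun n : ℕ => ?_)).mp this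
    have : (n : ℂ) + 1 ≠ 0 := by exact_mod_cast Nat.succ_ne_zero n
    push_cast
    field_simp
    exact pow_succ' z n

lemma conj_dirichletKernel (lam mu : unitDisc) :
    starRingEnd ℂ (dirichletKernel lam mu) = dirichletKernel mu lam := by
  have h := (hasSum_dirichletKernel lam mu).map (starRingEnd ℂ) Complex.continuous_conj
  refine h.unique ?_
  convert hasSum_dirichletKernel mu lam using 2 with n
  simp [mul_comm]

lemma dirichletKernel_form_nonneg (v : unitDisc →₀ ℂ) :
    0 ≤ RCLike.re (v.sum fun x w => v.sum fun x' w' =>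
      inner ℂ (dirichletKernelMatrix x' x w) w') := by
  have hs : HasSum (fun n : ℕ => ∑ x ∈ v.support, ∑ x' ∈ v.support,
      starRingEnd ℂ (((starRingEnd ℂ (x : ℂ)) * (x' : ℂ)) ^ n / ((n : ℂ) + 1))
        * (v x' * starRingEnd ℂ (v x)))
      (v.sum fun x w => v.sum fun x' w' => inner ℂ (dirichletKernelMatrix x' x w) w') := by
    refine hasSum_sum fun x _ => hasSum_sum fun x' _ => ?_
    have h := ((hasSum_dirichletKernel x x').map (starRingEnd ℂ)
      Complex.continuous_conj).mul_right (v x' * starRingEnd ℂ (v x))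
    have e : inner ℂ (dirichletKernelMatrix x' x (v x)) (v x') =
        starRingEnd ℂ (dirichletKernel x x') * (v x' * starRingEnd ℂ (v x)) := by
      simp [dirichletKernelMatrix]
      ring
    change HasSum _ (inner ℂ (dirichletKernelMatrix x' x (v x)) (v x'))
    exact e ▸ h
  refine ((Complex.hasSum_re hs)).nonneg fun n => ?_
  have : (∑ x ∈ v.support, ∑ x' ∈ v.support,
      starRingEnd ℂ (((starRingEnd ℂ (x : ℂ)) * (x' : ℂ)) ^ n / ((n : ℂ) + 1))
        * (v x' * starRingEnd ℂ (v x))) =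
      ((1 / ((n : ℝ) + 1) *
        Complex.normSq (∑ x ∈ v.support, starRingEnd ℂ ((x : ℂ) ^ n) * v x) : ℝ) : ℂ) := by
    push_cast
    rw [Complex.normSq_eq_conj_mul_self, map_sum, Finset.sum_mul_sum, Finset.mul_sum]
    refine Finset.sum_congr rfl fun x _ => ?_
    rw [Finset.mul_sum]
    refine Finset.sum_congr rfl fun x' _ => ?_
    simp [mul_pow]
    ring
  rw [this, Complex.ofReal_re]
  have := Complex.normSq_nonneg (∑ x ∈ v.support, starRingEnd ℂ ((x : ℂ) ^ n) * v x)
  positivity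

instance dirichletKernelMatrix_posSemidef : Fact dirichletKernelMatrix.PosSemidef := by
  have h : dirichletKernelMatrix.IsHermitian := by
    ext x y
    have hid : star (ContinuousLinearMap.id ℂ ℂ) = ContinuousLinearMap.id ℂ ℂ :=
      star_one (ℂ →L[ℂ] ℂ)
    simp [dirichletKernelMatrix, ← conj_dirichletKernel y x, star_smul, hid]
  have t : dirichletKernelMatrix.PosSemidef ↔
      (dirichletKernelMatrix.IsHermitian ∧ ∀ v : unitDisc →₀ ℂ,
        0 ≤ RCLike.re (v.sum fun x w => v.sum fun x' w' =>
          inner ℂ (dirichletKernelMatrix x' x w) w')) :=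
    (RKHS.posSemidef_tfae (K := dirichletKernelMatrix)).out 0 2
  exact ⟨t.2 ⟨h, dirichletKernel_form_nonneg⟩⟩

/-- The Dirichlet space, built from its kernel. -/
abbrev DirichletSpace : Type := RKHS.OfKernel dirichletKernelMatrix

/-! The engine is the complete Pick property of the kernel. In `t = conj lam * mu` the kernel is `∑
t ^ n / (n + 1)`, whose coefficients are log-convex, so Kaluza's lemma gives `1 - 1 / k = ∑ c n * t
^ (n + 1)` with `0 ≤ c n ≤ 1` (`exists_dirichletKernel_pick`). Such a series factors as `Z(w)
Z(u)^*` for a holomorphic row operator `Z` (`shiftRow`) with `‖Z(w)‖ < 1`, so `1 / k` becomes `1 -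
Z(w) Z(u)^*`.

The adjoint of a multiplier sends `k_w ⊗ v` to `k_w ⊗ φ(w)^* v`. Hence `φ` is contractive exactly
when `(1 - φ(w) φ(u)^*) k_u(w)` is a positive kernel (`isContractiveMultiplier_iff_posSemidef`), and
(i) implies (ii) because the Pick matrix is a restriction of this kernel.

For (ii) implies (i), a lurking contraction: factor the Pick matrix as a Gram matrix, divide by `k`,
and rearrange into an equality of two Gram matrices. This yields a contraction `V` between the two
families, and its transfer function (`exists_transfer_function`) interpolates. That `V` is a
contraction, together with the Schur product theorem, makes the multiplier kernel positive.

Analyticity holds because kernel functions are analytic and span a dense subspace, while norm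
convergence is locally uniform. -/

/-! ### Renewal sequences and the reciprocal of the Dirichlet kernel -/

/-- Kaluza's lemma: if `u` is positive with increasing ratios and `u 0 = 1`, then the renewal
sequence `c` of `u`, i.e. `1 - 1 / ∑ u n * t ^ n = ∑ c n * t ^ (n + 1)`, is nonnegative. -/
theorem exists_nonneg_renewal (u : ℕ → ℝ) (u_zero : u 0 = 1) (u_pos : ∀ n, 0 < u n)
    (u_log : ∀ l m, l ≤ m → u (l + 1) * u m ≤ u l * u (m + 1)) :
    ∃ c : ℕ → ℝ, (∀ n, 0 ≤ c n) ∧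
      ∀ n, u (n + 1) = ∑ p ∈ Finset.HasAntidiagonal.antidiagonal n, c p.1 * u p.2 := by
  have hunit : PowerSeries.constantCoeff (PowerSeries.mk u) ≠ 0 := by simp [u_zero]
  have hinv := PowerSeries.inv_mul_cancel _ hunit
  set v := (PowerSeries.mk u)⁻¹ with hv
  have hv0 : PowerSeries.coeff 0 v = 1 := by
    simp [hv, PowerSeries.constantCoeff_inv, u_zero]
  set c : ℕ → ℝ := fun n => - PowerSeries.coeff (n + 1) v with hc
  have hren : ∀ n, u (n + 1) = ∑ p ∈ Finset.HasAntidiagonal.antidiagonal n, c p.1 * u p.2 := by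
    intro n
    have h := congrArg (PowerSeries.coeff (n + 1)) hinv
    rw [PowerSeries.coeff_mul, Finset.Nat.antidiagonal_succ] at h
    simp only [Finset.sum_cons, Finset.sum_map, hv0, PowerSeries.coeff_mk, PowerSeries.coeff_one]
      at h
    simp only [Function.Embedding.prodMap, Function.Embedding.coeFn_mk] at h
    simp only [hc, neg_mul, Finset.sum_neg_distrib]
    simp at h
    linarith
  refine ⟨c, fun n => ?_, hren⟩
  induction n using Nat.strong_induction_on with
  | _ n ih =>
    rcases n with _ | n
    · have := hren 0
      simp [u_zero] at this
      rw [← this]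
      exact (u_pos 1).le
    · have h1 := hren (n + 1)
      have h2 := hren n
      rw [Finset.Nat.antidiagonal_succ'] at h1
      simp only [Finset.sum_cons, Finset.sum_map, u_zero, mul_one] at h1
      simp only [Function.Embedding.prodMap, Function.Embedding.coeFn_mk] at h1
      -- Log-convexity compares the convolution sums for `u (n + 2)` and `u (n + 1)` term by term.
      -- The first sum lacks only the summand `c (n + 1) * u 0`, so what remains is `0 ≤ u (n + 1) *
      -- c (n + 1)`.
      have h3 : u (n + 1) * ∑ p ∈ Finset.HasAntidiagonal.antidiagonal n, c p.1 * u (p.2 + 1) ≤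
          u (n + 2) * ∑ p ∈ Finset.HasAntidiagonal.antidiagonal n, c p.1 * u p.2 := by
        rw [Finset.mul_sum, Finset.mul_sum]
        refine Finset.sum_le_sum fun p hp => ?_
        have hp' := Finset.HasAntidiagonal.mem_antidiagonal.1 hp
        have := mul_le_mul_of_nonneg_left (u_log p.2 (n + 1) (by omega)) (ih p.1 (by omega))
        linarith
      rw [← h2] at h3
      simp at h1
      have h4 : 0 ≤ u (n + 1) * c (n + 1) := by
        rw [show n + 2 = n + 1 + 1 from rfl, h1] at h3
        nlinarith
      exact nonneg_of_mul_nonneg_right h4 (u_pos _)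

/-- The renewal sequence of `u` yields `1 - 1 / ∑ u n * t ^ n`. -/
theorem renewal_mul_eq_one {u c : ℕ → ℝ} (u_zero : u 0 = 1) (u_nonneg : ∀ n, 0 ≤ u n)
    (u_le : ∀ n, u n ≤ 1) (c_nonneg : ∀ n, 0 ≤ c n) (c_le : ∀ n, c n ≤ 1)
    (hren : ∀ n, u (n + 1) = ∑ p ∈ Finset.HasAntidiagonal.antidiagonal n, c p.1 * u p.2)
    {t : ℂ} (ht : ‖t‖ < 1) :
    (1 - ∑' n, (c n : ℂ) * t ^ (n + 1)) * ∑' n, (u n : ℂ) * t ^ n = 1 := by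
  have hgeo := summable_geometric_of_lt_one (norm_nonneg t) ht
  have bound : ∀ {a : ℕ → ℝ}, (∀ n, 0 ≤ a n) → (∀ n, a n ≤ 1) →
      Summable fun n => ‖(a n : ℂ) * t ^ n‖ := fun {a} h0 h1 => by
    refine Summable.of_nonneg_of_le (fun n => norm_nonneg _) (fun n => ?_) hgeo
    rw [norm_mul, norm_pow, Complex.norm_real, Real.norm_of_nonneg (h0 n)]
    exact mul_le_of_le_one_left (by positivity) (h1 n)
  have hu := bound u_nonneg u_le
  have hc := bound c_nonneg c_le
  have hprod := tsum_mul_tsum_eq_tsum_sum_antidiagonal_of_summable_norm hc hu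
  have hcoef : ∀ n, ∑ p ∈ Finset.HasAntidiagonal.antidiagonal n, ((c p.1 : ℂ) * t ^ p.1) * (u p.2 * t ^ p.2) =
      u (n + 1) * t ^ n := fun n => by
    rw [hren n, Complex.ofReal_sum, Finset.sum_mul]
    refine Finset.sum_congr rfl fun p hp => ?_
    rw [← Finset.HasAntidiagonal.mem_antidiagonal.1 hp]
    push_cast
    ring
  simp_rw [hcoef] at hprod
  have hsplit := hu.of_norm.tsum_eq_zero_add
  have e1 : ∑' n, (c n : ℂ) * t ^ (n + 1) = t * ∑' n, (c n : ℂ) * t ^ n := by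
    rw [← tsum_mul_left]
    exact tsum_congr fun n => by ring
  have e2 : ∑' n, (u (n + 1) : ℂ) * t ^ (n + 1) = t * ∑' n, (u (n + 1) : ℂ) * t ^ n := by
    rw [← tsum_mul_left]
    exact tsum_congr fun n => by ring
  rw [e2, ← hprod] at hsplit
  simp only [u_zero, pow_zero, Complex.ofReal_one, mul_one] at hsplit
  rw [e1]
  linear_combination hsplit

/-- `c n * u 0` is one term of a nonnegative sum with value `u (n + 1) ≤ 1`. -/
theorem le_one_of_renewal {u c : ℕ → ℝ} (u_zero : u 0 = 1) (u_nonneg : ∀ n, 0 ≤ u n)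
    (u_le : ∀ n, u n ≤ 1) (c_nonneg : ∀ n, 0 ≤ c n)
    (hren : ∀ n, u (n + 1) = ∑ p ∈ Finset.HasAntidiagonal.antidiagonal n, c p.1 * u p.2) (n : ℕ) : c n ≤ 1 := by
  have h := Finset.single_le_sum (f := fun p : ℕ × ℕ => c p.1 * u p.2)
    (fun p _ => mul_nonneg (c_nonneg p.1) (u_nonneg p.2))
    (show (n, 0) ∈ Finset.HasAntidiagonal.antidiagonal n by simp)
  simp only [u_zero, mul_one, ← hren n] at h
  exact h.trans (u_le _)

theorem tsum_dirichletKernel (lam mu : unitDisc) :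
    ∑' n : ℕ, (((n : ℝ) + 1)⁻¹ : ℝ) * (starRingEnd ℂ (lam : ℂ) * (mu : ℂ)) ^ n =
      dirichletKernel lam mu := by
  rw [← (hasSum_dirichletKernel lam mu).tsum_eq]
  refine tsum_congr fun n => ?_
  push_cast
  ring

/-- The Dirichlet kernel has the complete Pick property: `1 - 1 / k` is a power series in
`conj lam * mu` with nonnegative coefficients. -/
theorem exists_dirichletKernel_pick : ∃ c : ℕ → ℝ, (∀ n, 0 ≤ c n) ∧ (∀ n, c n ≤ 1) ∧
    ∀ lam mu : unitDisc,
      (1 - ∑' n, (c n : ℂ) * (starRingEnd ℂ (lam : ℂ) * (mu : ℂ)) ^ (n + 1)) *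
        dirichletKernel lam mu = 1 := by
  have u_pos : ∀ n : ℕ, (0 : ℝ) < ((n : ℝ) + 1)⁻¹ := fun n => by positivity
  have u_le : ∀ n : ℕ, ((n : ℝ) + 1)⁻¹ ≤ 1 := fun n => inv_le_one_of_one_le₀ (by simp)
  obtain ⟨c, hc, hren⟩ := exists_nonneg_renewal (fun n : ℕ => ((n : ℝ) + 1)⁻¹) (by simp) u_pos
    (fun l m h => by
      have h' : (l : ℝ) ≤ m := by exact_mod_cast h
      rw [← mul_inv, ← mul_inv]
      -- Log-convexity becomes `(l + 1) * (m + 2) ≤ (l + 2) * (m + 1)`, which is `l ≤ m`.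
      refine inv_anti₀ (by positivity) ?_
      push_cast
      nlinarith)
  have c_le := le_one_of_renewal (u := fun n : ℕ => ((n : ℝ) + 1)⁻¹) (by simp)
    (fun n => (u_pos n).le) u_le hc hren
  refine ⟨c, hc, c_le, fun lam mu => ?_⟩
  rw [← tsum_dirichletKernel]
  exact renewal_mul_eq_one (u := fun n : ℕ => ((n : ℝ) + 1)⁻¹) (by simp)
    (fun n => (u_pos n).le) u_le hc c_le hren (norm_conj_mul_lt_one lam mu)

/-! ### Gram matrices and contractions -/

section Hilbert

variable {X Y : Type*} [NormedAddCommGroup X] [InnerProductSpace ℂ X]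
  [NormedAddCommGroup Y] [InnerProductSpace ℂ Y]

/-- The inequality makes `x i ↦ y i` well defined and contractive on the span of `x`. It extends by
continuity to the closed span, and by zero on the orthogonal complement. -/
theorem exists_contraction_of_norm_linearCombination_le [CompleteSpace X] [CompleteSpace Y] {ι : Type*} {x : ι → X}
    {y : ι → Y} (h : ∀ c : ι →₀ ℂ, ‖Finsupp.linearCombination ℂ y c‖ ≤
      ‖Finsupp.linearCombination ℂ x c‖) :
    ∃ V : X →L[ℂ] Y, ‖V‖ ≤ 1 ∧ ∀ i, V (x i) = y i := by
  set L := Finsupp.linearCombination ℂ x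
  set M := (LinearMap.range L).topologicalClosure with hM
  have hmem : ∀ c, L c ∈ M := fun c =>
    (LinearMap.range L).le_topologicalClosure (LinearMap.mem_range_self L c)
  set e : (ι →₀ ℂ) →ₗ[ℂ] M := L.codRestrict M hmem
  have hdense : DenseRange e := by
    rw [denseRange_iff_closure_range, Set.eq_univ_iff_forall]
    intro m
    rw [closure_subtype]
    have hm : (m : X) ∈ closure (LinearMap.range L : Set X) := m.2
    refine closure_mono ?_ hm
    rintro _ ⟨c, rfl⟩
    exact ⟨e c, ⟨c, rfl⟩, rfl⟩
  have hnorm : ∀ c, ‖Finsupp.linearCombination ℂ y c‖ ≤ 1 * ‖e c‖ := fun c => by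
    rw [one_mul]
    exact h c
  have hMc : IsClosed (M : Set X) := (LinearMap.range L).isClosed_topologicalClosure
  have : CompleteSpace M := hMc.completeSpace_coe
  set V := (Finsupp.linearCombination ℂ y).extendOfNorm e
  refine ⟨V ∘L M.orthogonalProjectionOnto, ?_, fun i => ?_⟩
  · refine ContinuousLinearMap.opNorm_le_bound _ zero_le_one fun v => ?_
    refine (LinearMap.norm_extendOfNorm_apply_le hdense 1 hnorm _).trans ?_
    rw [one_mul, one_mul]
    exact M.norm_orthogonalProjectionOnto_apply_le v
  · have hx : e (Finsupp.single i 1) = ⟨x i, by simpa [L] using hmem (Finsupp.single i 1)⟩ :=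
      Subtype.ext (by simp [e, L])
    have := LinearMap.extendOfNorm_eq hdense ⟨1, hnorm⟩ (Finsupp.single i 1)
    rw [hx] at this
    rw [ContinuousLinearMap.comp_apply,
      Submodule.orthogonalProjectionOnto_mem_subspace_eq_self (K := M) ⟨x i, _⟩]
    simpa using this

-- The quadratic form of the difference at `c` is `‖∑ c i • x i‖ ^ 2 - ‖∑ c i • y i‖ ^ 2`.
open scoped ComplexOrder in
theorem posSemidef_gram_sub_gram_iff {ι : Type*} {x : ι → X} {y : ι → Y} :
    (Matrix.gram ℂ x - Matrix.gram ℂ y).PosSemidef ↔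
      ∀ c : ι →₀ ℂ, ‖Finsupp.linearCombination ℂ y c‖ ≤ ‖Finsupp.linearCombination ℂ x c‖ := by
  have key : ∀ c : ι →₀ ℂ, (c.sum fun i ci => c.sum fun j cj =>
      star ci * (Matrix.gram ℂ x - Matrix.gram ℂ y) i j * cj) =
      ((‖Finsupp.linearCombination ℂ x c‖ ^ 2 - ‖Finsupp.linearCombination ℂ y c‖ ^ 2 : ℝ) : ℂ) := by
    intro c
    push_cast
    have hx := inner_self_eq_norm_sq_to_K (𝕜 := ℂ) (Finsupp.linearCombination ℂ x c)
    have hy := inner_self_eq_norm_sq_to_K (𝕜 := ℂ) (Finsupp.linearCombination ℂ y c)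
    rw [RCLike.ofReal_eq_complex_ofReal] at hx hy
    rw [← hx, ← hy]
    simp only [Finsupp.linearCombination_apply, Finsupp.sum, sum_inner, inner_sum,
      inner_smul_left, inner_smul_right, Finset.mul_sum, ← Finset.sum_sub_distrib]
    rw [Finset.sum_comm]
    refine Finset.sum_congr rfl fun i _ => Finset.sum_congr rfl fun j _ => ?_
    simp only [Matrix.sub_apply, Matrix.gram_apply, RCLike.star_def]
    ring
  constructor
  · intro h c
    have := h.2 c
    rw [key, Complex.zero_le_real, sub_nonneg] at this
    exact (sq_le_sq₀ (norm_nonneg _) (norm_nonneg _)).1 this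
  · intro h
    refine ⟨(Matrix.isHermitian_gram ℂ x).sub (Matrix.isHermitian_gram ℂ y), fun c => ?_⟩
    rw [key, Complex.zero_le_real, sub_nonneg]
    exact pow_le_pow_left₀ (norm_nonneg _) (h c) 2

open scoped ComplexOrder in
/-- A family `y` is the image of a family `x` under a contraction if and only if the Gram matrix
of `x` dominates that of `y`. -/
theorem posSemidef_gram_sub_gram_iff_exists_contraction [CompleteSpace X] [CompleteSpace Y]
    {ι : Type*} {x : ι → X} {y : ι → Y} :
    (Matrix.gram ℂ x - Matrix.gram ℂ y).PosSemidef ↔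
      ∃ V : X →L[ℂ] Y, ‖V‖ ≤ 1 ∧ ∀ i, V (x i) = y i := by
  rw [posSemidef_gram_sub_gram_iff]
  refine ⟨exists_contraction_of_norm_linearCombination_le, ?_⟩
  rintro ⟨V, hV, hxy⟩ c
  have : Finsupp.linearCombination ℂ y c = V (Finsupp.linearCombination ℂ x c) := by
    simp [Finsupp.linearCombination_apply, Finsupp.sum, hxy]
  rw [this]
  exact V.le_of_opNorm_le hV _ |>.trans (one_mul _).le

open scoped ComplexOrder in
theorem posSemidef_gram_of_infinite {ι : Type*} (x : ι → X) : (Matrix.gram ℂ x).PosSemidef := by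
  have h := (posSemidef_gram_sub_gram_iff (x := x) (y := (0 : ι → X))).2 fun c => by
    simp [Finsupp.linearCombination_apply]
  simpa using h

open scoped ComplexOrder MatrixOrder Matrix.Norms.L2Operator in
/-- A positive semidefinite matrix is a Gram matrix. -/
theorem exists_gram_eq_of_posSemidef {ι : Type*} [Fintype ι] {P : Matrix ι ι ℂ}
    (hP : P.PosSemidef) : ∃ e : ι → EuclideanSpace ℂ ι, Matrix.gram ℂ e = P := by
  classical
  obtain ⟨B, rfl⟩ := CStarAlgebra.nonneg_iff_eq_star_mul_self.1 hP.nonneg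
  refine ⟨fun i => WithLp.toLp 2 fun k => B k i, ?_⟩
  ext i j
  simp [PiLp.inner_apply, Matrix.mul_apply, mul_comm]

end Hilbert

/-! ### The row contraction factoring `1 - 1 / k` -/

/-- Every Hilbert space `E` has a countable Hilbert direct power `G`, here described by its
coordinate projections. -/
theorem exists_hilbert_power.{u} (E : Type u) [NormedAddCommGroup E] [InnerProductSpace ℂ E]
    [CompleteSpace E] :
    ∃ (G : Type u) (_ : NormedAddCommGroup G) (_ : InnerProductSpace ℂ G) (_ : CompleteSpace G)
      (P : ℕ → G →L[ℂ] E), (∀ n, ‖P n‖ ≤ 1) ∧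
        (∀ n e, P n ((P n).adjoint e) = e) ∧
        ∀ n k, n ≠ k → ∀ e, P n ((P k).adjoint e) = 0 := by
  have hadj : ∀ (n : ℕ) (e : E), (lp.evalCLM ℂ (fun _ : ℕ => E) 2 n).adjoint e =
      lp.single 2 n e := fun n e => by
    refine ext_inner_right ℂ fun g => ?_
    rw [ContinuousLinearMap.adjoint_inner_left]
    exact (lp.inner_single_left (𝕜 := ℂ) (G := fun _ : ℕ => E) n e g).symm
  refine ⟨lp (fun _ : ℕ => E) 2, inferInstance, inferInstance, inferInstance,
    fun n => lp.evalCLM ℂ (fun _ : ℕ => E) 2 n, fun n => ?_, fun n e => ?_, fun n k h e => ?_⟩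
  · refine ContinuousLinearMap.opNorm_le_bound _ zero_le_one fun x => ?_
    rw [one_mul]
    exact lp.norm_apply_le_norm two_ne_zero x n
  · rw [hadj]
    exact lp.single_apply_self (E := fun _ : ℕ => E) 2 n e
  · rw [hadj]
    exact lp.single_apply_ne (E := fun _ : ℕ => E) 2 k e h

section ShiftRow

variable {E G : Type*} [NormedAddCommGroup E] [InnerProductSpace ℂ E]
  [NormedAddCommGroup G] [InnerProductSpace ℂ G]

/-- The row operator `∑ √(c n) w ^ (n + 1) P n`. -/
noncomputable def shiftRow (P : ℕ → G →L[ℂ] E) (c : ℕ → ℝ) (w : ℂ) : G →L[ℂ] E :=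
  ∑' n : ℕ, ((√(c n) : ℂ) * w ^ (n + 1)) • P n

variable {c : ℕ → ℝ} {P : ℕ → G →L[ℂ] E}

theorem norm_shiftRow_term_le (P_le : ∀ n, ‖P n‖ ≤ 1) (c_le : ∀ n, c n ≤ 1) {w : ℂ} {r : ℝ}
    (hr : r < 1) (hw : ‖w‖ ≤ r) (n : ℕ) :
    ‖((√(c n) : ℂ) * w ^ (n + 1)) • P n‖ ≤ r ^ n := by
  have h0 := norm_nonneg w
  have hr0 := h0.trans hw
  rw [norm_smul, norm_mul, norm_pow, Complex.norm_real, Real.norm_of_nonneg (Real.sqrt_nonneg _)]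
  have h1 : √(c n) ≤ 1 := Real.sqrt_le_one.2 (c_le n)
  have h2 : ‖w‖ ^ (n + 1) ≤ r ^ n :=
    (pow_le_pow_left₀ h0 hw _).trans (pow_le_pow_of_le_one hr0 hr.le n.le_succ)
  calc √(c n) * ‖w‖ ^ (n + 1) * ‖P n‖ ≤ 1 * r ^ n * 1 := by
        gcongr
        exact P_le n
    _ = r ^ n := by ring

variable [CompleteSpace E]

theorem hasSum_shiftRow (P_le : ∀ n, ‖P n‖ ≤ 1) (c_le : ∀ n, c n ≤ 1) {w : ℂ} (hw : ‖w‖ < 1) :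
    HasSum (fun n : ℕ => ((√(c n) : ℂ) * w ^ (n + 1)) • P n) (shiftRow P c w) :=
  (Summable.of_norm_bounded (summable_geometric_of_lt_one (norm_nonneg w) hw)
    (norm_shiftRow_term_le P_le c_le hw le_rfl)).hasSum

theorem hasSum_shiftRow_apply (P_le : ∀ n, ‖P n‖ ≤ 1) (c_le : ∀ n, c n ≤ 1) {w : ℂ}
    (hw : ‖w‖ < 1) (g : G) :
    HasSum (fun n : ℕ => ((√(c n) : ℂ) * w ^ (n + 1)) • P n g) (shiftRow P c w g) :=
  (hasSum_shiftRow P_le c_le hw).mapL (ContinuousLinearMap.apply ℂ E g)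

theorem differentiableOn_shiftRow (P_le : ∀ n, ‖P n‖ ≤ 1) (c_le : ∀ n, c n ≤ 1) :
    DifferentiableOn ℂ (shiftRow P c) unitDisc := by
  intro w hw
  rw [mem_ball_zero_iff] at hw
  obtain ⟨r, hwr, hr⟩ := exists_between hw
  have hr0 : 0 ≤ r := (norm_nonneg w).trans hwr.le
  have hd := Complex.differentiableOn_tsum_of_summable_norm
    (F := fun (n : ℕ) (v : ℂ) => ((√(c n) : ℂ) * v ^ (n + 1)) • P n)
    (summable_geometric_of_lt_one hr0 hr) (fun n => by fun_prop) Metric.isOpen_ball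
    (fun n v (hv : v ∈ Metric.ball (0 : ℂ) r) => norm_shiftRow_term_le P_le c_le hr
      (mem_ball_zero_iff.1 hv).le n)
  exact (hd.differentiableAt (Metric.isOpen_ball.mem_nhds
    (mem_ball_zero_iff.2 hwr))).differentiableWithinAt

variable [CompleteSpace G]

theorem apply_adjoint_shiftRow (P_le : ∀ n, ‖P n‖ ≤ 1) (P_self : ∀ n e, P n ((P n).adjoint e) = e)
    (P_ne : ∀ n k, n ≠ k → ∀ e, P n ((P k).adjoint e) = 0) (c_le : ∀ n, c n ≤ 1) {w : ℂ}
    (hw : ‖w‖ < 1) (e : E) (n : ℕ) :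
    P n ((shiftRow P c w).adjoint e) = ((√(c n) : ℂ) * starRingEnd ℂ w ^ (n + 1)) • e := by
  refine ext_inner_left ℂ fun a => ?_
  rw [← ContinuousLinearMap.adjoint_inner_left, ContinuousLinearMap.adjoint_inner_right]
  have h := hasSum_shiftRow_apply P_le c_le hw ((P n).adjoint a)
  have h' := hasSum_single (f := fun k : ℕ => ((√(c k) : ℂ) * w ^ (k + 1)) •
    P k ((P n).adjoint a)) n fun k hk => by rw [P_ne k n hk, smul_zero]
  rw [h.unique h', P_self]
  simp [inner_smul_left, inner_smul_right]

/-- `Z(w) Z(u)^*` is a scalar operator since the coordinates `P n` are mutually orthogonal. For the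
coefficients of the Pick property the scalar is `1 - 1 / k_u(w)`. -/
theorem inner_adjoint_shiftRow (P_le : ∀ n, ‖P n‖ ≤ 1) (P_self : ∀ n e, P n ((P n).adjoint e) = e)
    (P_ne : ∀ n k, n ≠ k → ∀ e, P n ((P k).adjoint e) = 0) (c_nonneg : ∀ n, 0 ≤ c n)
    (c_le : ∀ n, c n ≤ 1) {w u : ℂ} (hw : ‖w‖ < 1) (hu : ‖u‖ < 1) (e f : E) :
    inner ℂ ((shiftRow P c w).adjoint e) ((shiftRow P c u).adjoint f) =
      (∑' n, (c n : ℂ) * (starRingEnd ℂ u * w) ^ (n + 1)) * inner ℂ e f := by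
  rw [ContinuousLinearMap.adjoint_inner_left, ← tsum_mul_right]
  have h := (hasSum_shiftRow_apply P_le c_le hw ((shiftRow P c u).adjoint f)).mapL (innerSL ℂ e)
  rw [innerSL_apply_apply] at h
  rw [← h.tsum_eq]
  refine tsum_congr fun n => ?_
  rw [apply_adjoint_shiftRow P_le P_self P_ne c_le hu, innerSL_apply_apply, inner_smul_right,
    inner_smul_right]
  have : (c n : ℂ) = √(c n) * √(c n) := by
    rw [← Complex.ofReal_mul, Real.mul_self_sqrt (c_nonneg n)]
  rw [this]
  ring

/-- `Z(w) Z(w)^*` is the scalar `s = 1 - 1 / k`, and `(1 - s) * k = 1` with `k ≥ 0` forces `s < 1`.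
The strict bound is what makes the resolvent of the transfer function exist. -/
theorem norm_shiftRow_lt_one (P_le : ∀ n, ‖P n‖ ≤ 1) (P_self : ∀ n e, P n ((P n).adjoint e) = e)
    (P_ne : ∀ n k, n ≠ k → ∀ e, P n ((P k).adjoint e) = 0) (c_nonneg : ∀ n, 0 ≤ c n)
    (c_le : ∀ n, c n ≤ 1) {w : ℂ} (hw : ‖w‖ < 1) {k : ℝ} (hk : 0 ≤ k)
    (h : (1 - ∑' n, (c n : ℂ) * (starRingEnd ℂ w * w) ^ (n + 1)) * k = 1) :
    ‖shiftRow P c w‖ < 1 := by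
  have hs : ∑' n, (c n : ℂ) * (starRingEnd ℂ w * w) ^ (n + 1) =
      ((∑' n, c n * (‖w‖ ^ 2) ^ (n + 1) : ℝ) : ℂ) := by
    rw [Complex.ofReal_tsum]
    refine tsum_congr fun n => ?_
    rw [Complex.conj_mul']
    push_cast
    rfl
  set s := ∑' n, c n * (‖w‖ ^ 2) ^ (n + 1)
  have hs0 : 0 ≤ s := tsum_nonneg fun n => mul_nonneg (c_nonneg n) (by positivity)
  have h' : (1 - s) * k = 1 := by
    rw [hs] at h
    exact_mod_cast h
  have hs1 : s < 1 := by
    by_contra hcon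
    nlinarith
  rw [← LinearIsometryEquiv.norm_map ContinuousLinearMap.adjoint (shiftRow P c w)]
  refine lt_of_le_of_lt (ContinuousLinearMap.opNorm_le_bound _ (Real.sqrt_nonneg s) fun e => ?_)
    ((Real.sqrt_lt' one_pos).2 (by simpa using hs1))
  refine le_of_sq_le_sq ?_ (by positivity)
  have := inner_adjoint_shiftRow P_le P_self P_ne c_nonneg c_le hw hw e e
  rw [hs, inner_self_eq_norm_sq_to_K, inner_self_eq_norm_sq_to_K,
    RCLike.ofReal_eq_complex_ofReal] at this
  rw [mul_pow, Real.sq_sqrt hs0]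
  exact le_of_eq (by exact_mod_cast this)

end ShiftRow

/-! ### Transfer functions -/

/-- The transfer function of a colligation `V`. -/
theorem exists_transfer_function {K G E : Type*} [NormedAddCommGroup K] [InnerProductSpace ℂ K]
    [CompleteSpace K] [NormedAddCommGroup G] [InnerProductSpace ℂ G] [CompleteSpace G]
    [NormedAddCommGroup E] [InnerProductSpace ℂ E] [CompleteSpace E]
    (V : WithLp 2 (K × G) →L[ℂ] WithLp 2 (K × E)) (hV : ‖V‖ ≤ 1) {U : Set ℂ}
    {Z : ℂ → G →L[ℂ] E} (hZ : DifferentiableOn ℂ Z U) (Z_lt : ∀ w ∈ U, ‖Z w‖ < 1) :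
    ∃ (ψ : ℂ → K → K) (r : ℂ → K → E),
      (∀ w ∈ U, ∀ v, V (WithLp.toLp 2 (v, (Z w).adjoint (r w v))) = WithLp.toLp 2 (ψ w v, r w v)) ∧
      (∀ w ∈ U, ∀ v v' f, V (WithLp.toLp 2 (v, (Z w).adjoint f)) = WithLp.toLp 2 (v', f) →
        v' = ψ w v) ∧
      ∀ v v', DifferentiableOn ℂ (fun w => inner ℂ (ψ w v) v') U := by
  set ιK : K →L[ℂ] WithLp 2 (K × G) :=
    (WithLp.prodContinuousLinearEquiv 2 ℂ K G).symm ∘L ContinuousLinearMap.inl ℂ K G with hιK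
  set ιG : G →L[ℂ] WithLp 2 (K × G) :=
    (WithLp.prodContinuousLinearEquiv 2 ℂ K G).symm ∘L ContinuousLinearMap.inr ℂ K G with hιG
  set A := WithLp.fstL 2 ℂ K E ∘L V ∘L ιK
  set B := WithLp.fstL 2 ℂ K E ∘L V ∘L ιG
  set C := WithLp.sndL 2 ℂ K E ∘L V ∘L ιK
  set D := WithLp.sndL 2 ℂ K E ∘L V ∘L ιG with hDdef
  have hsplit : ∀ v g, V (WithLp.toLp 2 (v, g)) = WithLp.toLp 2 (A v + B g, C v + D g) := by
    intro v g
    have : (WithLp.toLp 2 (v, g) : WithLp 2 (K × G)) = ιK v + ιG g := by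
      apply WithLp.ofLp_injective
      simp [hιK, hιG]
    rw [this, map_add]
    rfl
  have hD : ‖D‖ ≤ 1 := by
    refine ContinuousLinearMap.opNorm_le_bound _ zero_le_one fun g => ?_
    have h1 : ‖D g‖ ≤ ‖V (WithLp.toLp 2 (0, g))‖ := by
      rw [hsplit]
      simp only [map_zero, zero_add]
      exact WithLp.norm_snd_le K (WithLp.toLp 2 (B g, D g))
    refine h1.trans ((V.le_of_opNorm_le hV _).trans (le_of_eq ?_))
    simp
  -- With `V` in blocks `A, B, C, D`, the state solves `r = C v + D Z(w)^* r`, so `r = (1 - D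
  -- Z(w)^*)⁻¹ C v`, uniquely. That inverse is antiholomorphic in `w`; its adjoint `R` is
  -- holomorphic, so `R` is the one defined.
  set R : ℂ → E →L[ℂ] E := fun w => Ring.inverse (1 - Z w ∘L D.adjoint)
  have hunit : ∀ w ∈ U, IsUnit (1 - Z w ∘L D.adjoint) := fun w hw => by
    refine isUnit_one_sub_of_norm_lt_one ?_
    refine (ContinuousLinearMap.opNorm_comp_le _ _).trans_lt ?_
    rw [LinearIsometryEquiv.norm_map]
    exact (mul_le_of_le_one_right (norm_nonneg _) hD).trans_lt (Z_lt w hw)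
  have hR : DifferentiableOn ℂ R U :=
    DifferentiableOn.inverse ((differentiableOn_const _).sub (hZ.clm_comp
      (differentiableOn_const _))) hunit
  have hadj : ∀ w, (1 - Z w ∘L D.adjoint).adjoint = 1 - D ∘L (Z w).adjoint := fun w => by
    rw [map_sub, ContinuousLinearMap.adjoint_comp, ContinuousLinearMap.adjoint_adjoint]
    congr 1
    exact star_one (E →L[ℂ] E)
  have hRadj : ∀ w ∈ U, ∀ e, (R w).adjoint e - D ((Z w).adjoint ((R w).adjoint e)) = e :=
    fun w hw e => by
      have h := congrArg (fun T : E →L[ℂ] E => ContinuousLinearMap.adjoint T e)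
        (Ring.inverse_mul_cancel _ (hunit w hw))
      simp only [ContinuousLinearMap.mul_def, ContinuousLinearMap.adjoint_comp, hadj] at h
      rw [show ContinuousLinearMap.adjoint (1 : E →L[ℂ] E) = 1 from star_one _] at h
      simpa using h
  have hadjR : ∀ w ∈ U, ∀ e, (R w).adjoint (e - D ((Z w).adjoint e)) = e :=
    fun w hw e => by
      have h := congrArg (fun T : E →L[ℂ] E => ContinuousLinearMap.adjoint T e)
        (Ring.mul_inverse_cancel _ (hunit w hw))
      simp only [ContinuousLinearMap.mul_def, ContinuousLinearMap.adjoint_comp, hadj] at h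
      rw [show ContinuousLinearMap.adjoint (1 : E →L[ℂ] E) = 1 from star_one _] at h
      simpa using h
  refine ⟨fun w v => A v + B ((Z w).adjoint ((R w).adjoint (C v))),
    fun w v => (R w).adjoint (C v), fun w hw v => ?_, fun w hw v v' f h => ?_, fun v v' => ?_⟩
  · rw [hsplit]
    congr 2
    exact (sub_eq_iff_eq_add.1 (hRadj w hw (C v))).symm
  · rw [hsplit] at h
    have h1 := congrArg (fun p => (WithLp.ofLp p).1) h
    have h2 := congrArg (fun p => (WithLp.ofLp p).2) h
    simp only at h1 h2
    have h3 : f = (R w).adjoint (C v) := by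
      rw [← hadjR w hw f, ← sub_eq_iff_eq_add.2 h2.symm]
    change v' = A v + B ((Z w).adjoint ((R w).adjoint (C v)))
    rw [← h1, ← h3]
  -- `ψ` is antiholomorphic, but it sits in the conjugate-linear slot; moving the adjoints across
  -- leaves only the holomorphic `R` and `Z`.
  · have : ∀ w, inner ℂ (A v + B ((Z w).adjoint ((R w).adjoint (C v)))) v' =
        inner ℂ (A v) v' + innerSL ℂ (C v) (R w (Z w (B.adjoint v'))) := fun w => by
      rw [inner_add_left, ← ContinuousLinearMap.adjoint_inner_right B,
        ContinuousLinearMap.adjoint_inner_left, ContinuousLinearMap.adjoint_inner_left]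
      rfl
    simp_rw [this]
    refine (differentiableOn_const _).add ?_
    exact (innerSL ℂ (C v)).differentiable.comp_differentiableOn
      (hR.clm_apply (hZ.clm_apply (differentiableOn_const _)))

/-! ### Multipliers and positive kernels -/

section Multiplier

variable {U : Set ℂ} {H : Type*} [NormedAddCommGroup H] [InnerProductSpace ℂ H] [CompleteSpace H]
  [RKHS ℂ H U ℂ] {m : ℕ}

theorem inner_kerFun_kerFun (w u : U) :
    inner ℂ (RKHS.kerFun H w (1 : ℂ)) (RKHS.kerFun H u (1 : ℂ)) = reproducingKernel H u w := by
  rw [RKHS.kerFun_inner]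
  simp [reproducingKernel]

/-- The kernel vector `k_w ⊗ v` of `ℂᵐ ⊗ H`. -/
noncomputable def kernelVector (H : Type*) [NormedAddCommGroup H] [InnerProductSpace ℂ H]
    [CompleteSpace H] [RKHS ℂ H U ℂ] (w : U) (v : Fin m → ℂ) : PiLp 2 (fun _ : Fin m => H) :=
  WithLp.toLp 2 fun a => v a • RKHS.kerFun H w (1 : ℂ)

theorem inner_kernelVector (w : U) (v : Fin m → ℂ) (f : PiLp 2 (fun _ : Fin m => H)) :
    inner ℂ (kernelVector H w v) f = ∑ a, starRingEnd ℂ (v a) * (f a) w := by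
  rw [PiLp.inner_apply]
  refine Finset.sum_congr rfl fun a _ => ?_
  change inner ℂ (v a • RKHS.kerFun H w (1 : ℂ)) (f a) = _
  rw [inner_smul_left, RKHS.kerFun_inner]
  simp

theorem inner_kernelVector_kernelVector (w u : U) (v v' : Fin m → ℂ) :
    inner ℂ (kernelVector H w v) (kernelVector H u v') =
      (∑ a, starRingEnd ℂ (v a) * v' a) * reproducingKernel H u w := by
  rw [PiLp.inner_apply, Finset.sum_mul]
  refine Finset.sum_congr rfl fun a _ => ?_
  change inner ℂ (v a • RKHS.kerFun H w (1 : ℂ)) (v' a • RKHS.kerFun H u (1 : ℂ)) = _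
  rw [inner_smul_left, inner_smul_right, inner_kerFun_kerFun, mul_assoc]

/-- The kernel `(1 - φ(w) φ(u)^*) k_u(w)`, as an infinite matrix. -/
noncomputable def multiplierKernel (H : Type*) [NormedAddCommGroup H] [InnerProductSpace ℂ H]
    [CompleteSpace H] [RKHS ℂ H U ℂ] (φ : ℂ → Matrix (Fin m) (Fin m) ℂ) :
    Matrix (U × Fin m) (U × Fin m) ℂ :=
  Matrix.of fun p q =>
    ((1 : Matrix (Fin m) (Fin m) ℂ) - φ p.1 * (φ q.1).conjTranspose) p.2 q.2
      * reproducingKernel H q.1 p.1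

theorem multiplierKernel_eq_gram_sub_gram (φ : ℂ → Matrix (Fin m) (Fin m) ℂ) :
    multiplierKernel H φ =
      Matrix.gram ℂ (fun p : U × Fin m => kernelVector H p.1 (Pi.single p.2 1)) -
      Matrix.gram ℂ (fun p : U × Fin m =>
        kernelVector H p.1 fun b => starRingEnd ℂ (φ p.1 p.2 b)) := by
  ext p q
  rw [Matrix.sub_apply, Matrix.gram_apply, Matrix.gram_apply, inner_kernelVector_kernelVector,
    inner_kernelVector_kernelVector, ← sub_mul]
  simp only [multiplierKernel, Matrix.of_apply, Matrix.sub_apply, Matrix.mul_apply,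
    Matrix.conjTranspose_apply, Complex.conj_conj, RCLike.star_def]
  congr 2
  simp [Pi.single_apply, Matrix.one_apply, eq_comm]

-- The two Gram families are `k_w ⊗ e_a` and `k_w ⊗ φ(w)^* e_a`. Pairing with them gives `(f a) w`
-- and `(φ f)_a (w)`, so a contraction carrying the first to the second is exactly the adjoint of
-- multiplication by `φ`.
open scoped ComplexOrder in
theorem isContractiveMultiplier_iff_posSemidef (φ : ℂ → Matrix (Fin m) (Fin m) ℂ) :
    IsContractiveMultiplier H φ ↔ (multiplierKernel H φ).PosSemidef := by
  rw [multiplierKernel_eq_gram_sub_gram, posSemidef_gram_sub_gram_iff_exists_contraction]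
  have hx : ∀ (w : U) (a : Fin m) (f : PiLp 2 (fun _ : Fin m => H)),
      inner ℂ (kernelVector H w (Pi.single a 1)) f = (f a) w := fun w a f => by
    rw [inner_kernelVector, Finset.sum_eq_single a]
    · simp
    · intro b _ hb
      simp [hb]
    · simp
  have hy : ∀ (w : U) (a : Fin m) (f : PiLp 2 (fun _ : Fin m => H)),
      inner ℂ (kernelVector H w fun b => starRingEnd ℂ (φ w a b)) f =
        ∑ b, φ w a b * (f b) w := fun w a f => by
    simp [inner_kernelVector]
  constructor
  · rintro ⟨T, hT, hT1⟩
    refine ⟨T.adjoint, by rwa [LinearIsometryEquiv.norm_map], fun p => ?_⟩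
    refine ext_inner_right ℂ fun f => ?_
    rw [ContinuousLinearMap.adjoint_inner_left, hx, hy, hT]
  · rintro ⟨S, hS1, hS⟩
    refine ⟨S.adjoint, fun f w a => ?_, by rwa [LinearIsometryEquiv.norm_map]⟩
    rw [← hx, ContinuousLinearMap.adjoint_inner_right, hS (w, a), hy]

theorem pickMatrix_eq_submatrix {n : ℕ} {lam : Fin n → U} {z : Fin n → Matrix (Fin m) (Fin m) ℂ}
    {φ : ℂ → Matrix (Fin m) (Fin m) ℂ} (h : ∀ i, φ (lam i) = z i) :
    pickMatrix H lam z = (multiplierKernel H φ).submatrix (fun p => (lam p.1, p.2))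
      (fun p => (lam p.1, p.2)) := by
  ext p q
  simp [pickMatrix, multiplierKernel, h]

end Multiplier

/-! ### Solving the matrix Pick problem -/

section Disc

variable {H : Type*} [NormedAddCommGroup H] [InnerProductSpace ℂ H] [CompleteSpace H]
  [RKHS ℂ H unitDisc ℂ] {m n : ℕ}

open scoped ComplexOrder in
/-- If `1 - 1 / k` is a power series in `conj lam * mu` with coefficients in `[0, 1]`, every
matrix Pick problem with positive semidefinite Pick matrix has a holomorphic contractive
solution. -/
theorem exists_multiplier_of_posSemidef_pickMatrix {c : ℕ → ℝ} (c_nonneg : ∀ n, 0 ≤ c n)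
    (c_le : ∀ n, c n ≤ 1)
    (hk : ∀ lam mu : unitDisc,
      (1 - ∑' n, (c n : ℂ) * (starRingEnd ℂ (lam : ℂ) * (mu : ℂ)) ^ (n + 1)) *
        reproducingKernel H lam mu = 1)
    {lam : Fin n → unitDisc} {z : Fin n → Matrix (Fin m) (Fin m) ℂ}
    (hpick : (pickMatrix H lam z).PosSemidef) :
    ∃ φ : ℂ → Matrix (Fin m) (Fin m) ℂ,
      (∀ a b, DifferentiableOn ℂ (fun w => φ w a b) unitDisc) ∧
      (∀ i, φ (lam i) = z i) ∧ (multiplierKernel H φ).PosSemidef := by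
  obtain ⟨e, he⟩ := exists_gram_eq_of_posSemidef hpick
  obtain ⟨G, _, _, _, P, P_le, P_self, P_ne⟩ :=
    exists_hilbert_power (EuclideanSpace ℂ (Fin n × Fin m))
  have hdisc : ∀ w : unitDisc, ‖(w : ℂ)‖ < 1 := fun w => mem_ball_zero_iff.1 w.2
  have hZ := differentiableOn_shiftRow P_le c_le
  set Z := shiftRow P c
  have hinner : ∀ (w u : unitDisc) f g, inner ℂ ((Z w).adjoint f) ((Z u).adjoint g) =
      (∑' n, (c n : ℂ) * (starRingEnd ℂ (u : ℂ) * w) ^ (n + 1)) * inner ℂ f g := fun w u f g =>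
    inner_adjoint_shiftRow P_le P_self P_ne c_nonneg c_le (hdisc w) (hdisc u) f g
  have Z_lt : ∀ w ∈ unitDisc, ‖Z w‖ < 1 := fun w hw => by
    refine norm_shiftRow_lt_one P_le P_self P_ne c_nonneg c_le (mem_ball_zero_iff.1 hw)
      (sq_nonneg ‖RKHS.kerFun H (⟨w, hw⟩ : unitDisc) (1 : ℂ)‖) ?_
    have h := hk ⟨w, hw⟩ ⟨w, hw⟩
    rw [← inner_kerFun_kerFun, inner_self_eq_norm_sq_to_K, RCLike.ofReal_eq_complex_ofReal] at h
    exact_mod_cast h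
  set x : Fin n × Fin m → WithLp 2 (EuclideanSpace ℂ (Fin m) × G) := fun p =>
    WithLp.toLp 2 (EuclideanSpace.single p.2 1, (Z (lam p.1)).adjoint (e p)) with hx
  set y : Fin n × Fin m →
      WithLp 2 (EuclideanSpace ℂ (Fin m) × EuclideanSpace ℂ (Fin n × Fin m)) := fun p =>
    WithLp.toLp 2 (WithLp.toLp 2 fun b => starRingEnd ℂ (z p.1 p.2 b), e p) with hy
  -- Dividing the Pick matrix by `k` gives `1 - z_i z_j^* = (1 - Z(w) Z(u)^*) ⟨e p, e q⟩` entrywise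
  -- at the nodes; moving the negative terms across equates the two Gram matrices.
  have hgram : Matrix.gram ℂ x - Matrix.gram ℂ y = 0 := by
    ext p q
    have h1 := congrFun (congrFun he p) q
    simp only [Matrix.gram_apply, pickMatrix, Matrix.of_apply] at h1
    have h2 := hk (lam q.1) (lam p.1)
    have hz : inner ℂ (WithLp.toLp 2 fun b => starRingEnd ℂ (z p.1 p.2 b) :
        EuclideanSpace ℂ (Fin m)) (WithLp.toLp 2 fun b => starRingEnd ℂ (z q.1 q.2 b)) =
        (z p.1 * (z q.1).conjTranspose) p.2 q.2 := by
      simp [PiLp.inner_apply, Matrix.mul_apply, mul_comm]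
    have hone : inner ℂ (EuclideanSpace.single p.2 (1 : ℂ)) (EuclideanSpace.single q.2 (1 : ℂ)) =
        (1 : Matrix (Fin m) (Fin m) ℂ) p.2 q.2 := by
      simp [Matrix.one_apply, EuclideanSpace.inner_single_left]
    simp only [Matrix.sub_apply, Matrix.gram_apply, WithLp.prod_inner_apply, hx, hy, hinner, hz,
      hone, Matrix.zero_apply]
    rw [Matrix.sub_apply] at h1
    rw [h1]
    linear_combination
      (-((1 : Matrix (Fin m) (Fin m) ℂ) p.2 q.2 - (z p.1 * (z q.1).conjTranspose) p.2 q.2)) * h2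
  obtain ⟨V, hV, hxy⟩ := posSemidef_gram_sub_gram_iff_exists_contraction.1
    (hgram ▸ Matrix.PosSemidef.zero)
  obtain ⟨ψ, r, hr, hψ, hdiff⟩ := exists_transfer_function V hV hZ Z_lt
  -- These entries say `φ(w)^* = ψ(w)`. At a node, `V (x p) = y p` solves the state equation with
  -- state `e p`, so uniqueness gives `ψ(lam i) = z_i^*`.
  refine ⟨fun w => Matrix.of fun a b =>
      inner ℂ (ψ w (EuclideanSpace.single a 1)) (EuclideanSpace.single b (1 : ℂ)),
    fun a b => hdiff _ _, fun i => ?_, ?_⟩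
  · ext a b
    change inner ℂ (ψ (lam i) (EuclideanSpace.single a 1)) (EuclideanSpace.single b (1 : ℂ)) = _
    rw [← hψ _ (lam i).2 _ _ _ (hxy (i, a))]
    simp [EuclideanSpace.inner_single_right]
  · set φ : ℂ → Matrix (Fin m) (Fin m) ℂ := fun w => Matrix.of fun a b =>
      inner ℂ (ψ w (EuclideanSpace.single a 1)) (EuclideanSpace.single b (1 : ℂ)) with hφ
    set ρ : unitDisc × Fin m → EuclideanSpace ℂ (Fin n × Fin m) := fun p =>
      r p.1 (EuclideanSpace.single p.2 1) with hρ
    set X : unitDisc × Fin m → WithLp 2 (EuclideanSpace ℂ (Fin m) × G) := fun p =>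
      WithLp.toLp 2 (EuclideanSpace.single p.2 1, (Z p.1).adjoint (ρ p)) with hX
    set Y : unitDisc × Fin m →
        WithLp 2 (EuclideanSpace ℂ (Fin m) × EuclideanSpace ℂ (Fin n × Fin m)) := fun p =>
      WithLp.toLp 2 (ψ p.1 (EuclideanSpace.single p.2 1), ρ p) with hY
    have hXY : (Matrix.gram ℂ X - Matrix.gram ℂ Y).PosSemidef :=
      posSemidef_gram_sub_gram_iff_exists_contraction.2 ⟨V, hV, fun p => hr _ p.1.2 _⟩
    -- The Gram difference is `1 - φ(w) φ(u)^* - ⟨ρ p, ρ q⟩ / k`. The Schur product with `k` clears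
    -- the denominator, and adding the Gram matrix of `ρ` cancels the last term.
    have hsum := ((posSemidef_gram_of_infinite
      (fun p : unitDisc × Fin m => RKHS.kerFun H p.1 (1 : ℂ))).hadamard hXY).add
      (posSemidef_gram_of_infinite ρ)
    refine Eq.subst (motive := Matrix.PosSemidef) ?_ hsum
    ext p q
    have h2 := hk q.1 p.1
    have hψφ : inner ℂ (ψ p.1 (EuclideanSpace.single p.2 1)) (ψ q.1 (EuclideanSpace.single q.2 1)) =
        (φ p.1 * (φ q.1).conjTranspose) p.2 q.2 := by
      simp [PiLp.inner_apply, Matrix.mul_apply, mul_comm, hφ]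
    have hone : inner ℂ (EuclideanSpace.single p.2 (1 : ℂ)) (EuclideanSpace.single q.2 (1 : ℂ)) =
        (1 : Matrix (Fin m) (Fin m) ℂ) p.2 q.2 := by
      simp [Matrix.one_apply, EuclideanSpace.inner_single_left]
    simp only [multiplierKernel, Matrix.of_apply, Matrix.add_apply, Matrix.hadamard_apply,
      Matrix.sub_apply, Matrix.gram_apply, WithLp.prod_inner_apply, hX, hY, hinner, hψφ, hone,
      inner_kerFun_kerFun]
    linear_combination (-inner ℂ (ρ p) (ρ q)) * h2

open scoped ComplexOrder in
theorem isCompleteInterpolationSpace_of_hasDirichletKernel (hH : HasDirichletKernel H) :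
    IsCompleteInterpolationSpace H := by
  obtain ⟨c, c_nonneg, c_le, hk⟩ := exists_dirichletKernel_pick
  intro m _ n _ lam _ z
  constructor
  · rintro ⟨φ, -, hφ, hmul⟩
    rw [pickMatrix_eq_submatrix hφ]
    exact ((isContractiveMultiplier_iff_posSemidef φ).1 hmul).submatrix _
  · intro hpick
    obtain ⟨φ, hd, hφ, hmul⟩ := exists_multiplier_of_posSemidef_pickMatrix c_nonneg c_le
      (fun lam mu => by rw [hH]; exact hk lam mu) hpick
    exact ⟨φ, hd, hφ, (isContractiveMultiplier_iff_posSemidef φ).2 hmul⟩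

/-! ### Analyticity of the elements -/

theorem norm_kerFun_sq_le (hH : HasDirichletKernel H) {r : ℝ} (hr : r < 1) (w : unitDisc)
    (hw : ‖(w : ℂ)‖ ≤ r) : ‖RKHS.kerFun H w (1 : ℂ)‖ ^ 2 ≤ (1 - r)⁻¹ := by
  have h0 := norm_nonneg (w : ℂ)
  have hr0 : 0 ≤ r := h0.trans hw
  have h : ‖dirichletKernel w w‖ = ‖RKHS.kerFun H w (1 : ℂ)‖ ^ 2 := by
    rw [← hH, ← inner_kerFun_kerFun, inner_self_eq_norm_sq_to_K]
    simp
  rw [← h, ← (hasSum_dirichletKernel w w).tsum_eq]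
  refine tsum_of_norm_bounded (hasSum_geometric_of_lt_one hr0 hr) fun n => ?_
  have h1 : ‖starRingEnd ℂ (w : ℂ) * w‖ ≤ r := by
    rw [norm_mul, RCLike.norm_conj]
    nlinarith
  have h2 : ‖(n : ℂ) + 1‖ = n + 1 := by
    rw [← Nat.cast_succ, Complex.norm_natCast, Nat.cast_succ]
  rw [norm_div, norm_pow, h2]
  exact (div_le_self (by positivity) (by simp)).trans (pow_le_pow_left₀ (norm_nonneg _) h1 n)

theorem exists_differentiableOn_kerFun (hH : HasDirichletKernel H) (lam : unitDisc) (v : ℂ) :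
    ∃ F : ℂ → ℂ, DifferentiableOn ℂ F unitDisc ∧
      ∀ w : unitDisc, F w = RKHS.kerFun H lam v w := by
  refine ⟨fun w => v * ∑' n : ℕ, (starRingEnd ℂ (lam : ℂ) * w) ^ n / ((n : ℂ) + 1), ?_, ?_⟩
  · refine DifferentiableOn.const_mul (Complex.differentiableOn_tsum_of_summable_norm
      (summable_geometric_of_lt_one (norm_nonneg (lam : ℂ)) (mem_ball_zero_iff.1 lam.2))
      (fun n => by fun_prop) Metric.isOpen_ball fun n w hw => ?_) v
    have h2 : ‖(n : ℂ) + 1‖ = n + 1 := by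
      rw [← Nat.cast_succ, Complex.norm_natCast, Nat.cast_succ]
    rw [norm_div, norm_pow, h2, norm_mul, RCLike.norm_conj]
    have hw' := (mem_ball_zero_iff.1 hw).le
    exact (div_le_self (by positivity) (by simp)).trans
      (pow_le_pow_left₀ (by positivity) (mul_le_of_le_one_right (norm_nonneg _) hw') n)
  · intro w
    have h : RKHS.kerFun H lam v = v • RKHS.kerFun H lam (1 : ℂ) := by
      rw [← map_smul, smul_eq_mul, mul_one]
    rw [h, RKHS.coe_smul, Pi.smul_apply, smul_eq_mul]
    refine congrArg (v * ·) ?_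
    exact (hasSum_dirichletKernel lam w).tsum_eq.trans (hH lam w).symm

/-- Evaluation at `w` has norm `‖k_w‖`, which is bounded on each smaller disc, so norm convergence
is locally uniform there and preserves holomorphy. -/
theorem exists_differentiableOn_of_tendsto (hH : HasDirichletKernel H) {f : ℕ → H} {g : H}
    (hf : ∀ n, ∃ F : ℂ → ℂ, DifferentiableOn ℂ F unitDisc ∧ ∀ w : unitDisc, F w = f n w)
    (hfg : Filter.Tendsto f Filter.atTop (nhds g)) :
    ∃ F : ℂ → ℂ, DifferentiableOn ℂ F unitDisc ∧ ∀ w : unitDisc, F w = g w := by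
  choose F hF hFf using hf
  have hext : ∀ w : unitDisc, Function.extend Subtype.val g 0 (w : ℂ) = g w := fun w =>
    Subtype.val_injective.extend_apply _ _ _
  refine ⟨Function.extend Subtype.val g 0, ?_, hext⟩
  have hlim : TendstoLocallyUniformlyOn F (Function.extend Subtype.val g 0) Filter.atTop
      unitDisc := by
    rw [Metric.tendstoLocallyUniformlyOn_iff]
    intro ε hε w hw
    obtain ⟨r, hwr, hr⟩ := exists_between (mem_ball_zero_iff.1 hw)
    refine ⟨Metric.ball 0 r, mem_nhdsWithin_of_mem_nhds
      (Metric.isOpen_ball.mem_nhds (mem_ball_zero_iff.2 hwr)), ?_⟩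
    have h := ((tendsto_iff_norm_sub_tendsto_zero.1 hfg).mul_const √((1 - r)⁻¹))
    rw [zero_mul] at h
    filter_upwards [h.eventually (gt_mem_nhds hε)] with k hk u hu
    rw [mem_ball_zero_iff] at hu
    set u' : unitDisc := ⟨u, mem_ball_zero_iff.2 (hu.trans hr)⟩
    change dist (Function.extend Subtype.val g 0 (u' : ℂ)) (F k (u' : ℂ)) < ε
    refine lt_of_le_of_lt ?_ hk
    rw [hext, hFf, dist_comm, dist_eq_norm, ← Pi.sub_apply, ← RKHS.coe_sub]
    have h1 : (f k - g : H) u' = inner ℂ (RKHS.kerFun H u' (1 : ℂ)) (f k - g) := by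
      rw [RKHS.kerFun_inner]
      simp
    rw [h1, mul_comm]
    refine (norm_inner_le_norm _ _).trans ?_
    gcongr
    exact Real.le_sqrt_of_sq_le (norm_kerFun_sq_le hH hr u' hu.le)
  exact hlim.differentiableOn (Filter.Eventually.of_forall hF) Metric.isOpen_ball

theorem isSpaceOfAnalyticFunctions_of_hasDirichletKernel (hH : HasDirichletKernel H) :
    IsSpaceOfAnalyticFunctions H := by
  have hspan : ∀ f ∈ Submodule.span ℂ {RKHS.kerFun H x v | (x : unitDisc) (v : ℂ)},
      ∃ F : ℂ → ℂ, DifferentiableOn ℂ F unitDisc ∧ ∀ w : unitDisc, F w = f w := by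
    intro f hf
    induction hf using Submodule.span_induction with
    | mem f hf =>
      obtain ⟨x, v, rfl⟩ := hf
      exact exists_differentiableOn_kerFun hH x v
    | zero => exact ⟨0, differentiableOn_const _, fun w => by simp⟩
    | add f g _ _ hf hg =>
      obtain ⟨F, hF, hFf⟩ := hf
      obtain ⟨F', hF', hFg⟩ := hg
      exact ⟨F + F', hF.add hF', fun w => by simp [hFf, hFg]⟩
    | smul a f _ hf =>
      obtain ⟨F, hF, hFf⟩ := hf
      exact ⟨a • F, hF.const_smul a, fun w => by simp [hFf]⟩
  intro g
  have hg : g ∈ (Submodule.span ℂ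
      {RKHS.kerFun H x v | (x : unitDisc) (v : ℂ)}).topologicalClosure := by
    rw [RKHS.kerFun_dense]
    trivial
  obtain ⟨f, hf, hfg⟩ := mem_closure_iff_seq_limit.1 hg
  exact exists_differentiableOn_of_tendsto hH (fun n => hspan _ (hf n)) hfg

end Disc

theorem hasDirichletKernel_dirichletSpace : HasDirichletKernel DirichletSpace := by
  intro lam mu
  rw [reproducingKernel, RKHS.kerFun_apply, RKHS.OfKernel.kernel_ofKernel]
  simp [dirichletKernelMatrix]

theorem theorem4p1 :
    HasDirichletKernel DirichletSpace ∧
    ∀ (H : Type*) [NormedAddCommGroup H] [InnerProductSpace ℂ H] [CompleteSpace H]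
      [RKHS ℂ H unitDisc ℂ], HasDirichletKernel H →
        IsSpaceOfAnalyticFunctions H ∧ IsCompleteInterpolationSpace H :=
  ⟨hasDirichletKernel_dirichletSpace, fun _ _ _ _ _ hH =>
    ⟨isSpaceOfAnalyticFunctions_of_hasDirichletKernel hH,
      isCompleteInterpolationSpace_of_hasDirichletKernel hH⟩⟩
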